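/- Let $d\in\mathbb N$ and $\sigma>0$. For $n\in\mathbb N_0^d$ write $|n|=n_1+\dots+n_d$, $n!=n_1!\cdots n_d!$, $2n=(2n_1,\dots,2n_d)$. Let $\ell_{\flat_\sigma}(\mathbb N_0^d)$ be the space of complex sequences $(a_n)_{n\in\mathbb N_0^d}$ such that $\sup_n |a_n|\,h^{|n|}\,(n!)^{1/(2\sigma)}<\infty$ for some $h>0$. Let $l_n(x)=\prod_{j=1}^d L_{n_j}(x_j)e^{-x_j/2}$, $x\in[0,\infty)^d$, be the Laguerre functions, where $L_m(t)=\frac{e^t}{m!}\frac{d^m}{dt^m}(e^{-t}t^m)$, and let $h_n(x)=\prod_{j=1}^d (2^{n_j}n_j!\sqrt\pi)^{-1/2}e^{-x_j^2/2}H_{n_j}(x_j)$, $x\in\mathbb R^d$, be the Hermite functions, where $H_m(t)=(-1)^me^{t^2}\frac{d^m}{dt^m}e^{-t^2}$. Put $$\mathcal G_{\flat_\sigma}(\mathbb R^d_+)=\Big\{\sum_n a_nl_n : (a_n)\in\ell_{\flat_{\sigma/2}}(\mathbb N_0^d)\Big\},\qquad \mathcal H_{\flat_\sigma}(\mathbb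 R^d)=\Big\{\sum_n a_nh_n : (a_n)\in\ell_{\flat_\sigma}(\mathbb N_0^d)\Big\},$$ where the series converge absolutely at every point of $[0,\infty)^d$, respectively of $\mathbb R^d$, and let $\mathcal H_{\flat_\sigma,even}(\mathbb R^d)$ be the space of those functions in $\mathcal H_{\flat_\sigma}(\mathbb R^d)$ that are even in each variable. Let $v(x)=(x_1^2,\dots,x_d^2)$ for $x\in\mathbb R^d$. If $f\in\mathcal G_{\flat_\sigma}(\mathbb R^d_+)$ has the Laguerre coefficients $a_n(f)=\int_{\mathbb R^d_+}f(x)l_n(x)\,dx$, then $f\circ v\in\mathcal H_{\flat_\sigma,even}(\mathbb R^d)$ and $$f\circ v=\sum_{n\in\mathbb N_0^d}b_{2n}h_{2n}\quad\text{pointwise on }\mathbb R^d,$$ where $$b_{2n}=\frac{(-1)^{|n|}\pi^{d/4}\sqrt{(2n)!}}{2^{|n|}\,n!}\sum_{k\in\mathbb N_0^d}a_{k+n}(f)\prod_{j=1}^d\binom{k_j-\frac12}{k_j},\qquad n\in\mathbb N_0^d,$$ the last series being absolutely convergent. Moreover, the sequence $(b_k)_{k\in\mathbb N_0^d}$ obtained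 by putting $b_k=0$ for every $k$ that is not of the form $2n$ belongs to $\ell_{\flat_\sigma}(\mathbb N_0^d)$, and it is the sequence of the Hermite coefficients of $f\circ v$: for every $k\in\mathbb N_0^d$ the function $(f\circ v)h_k$ is integrable and $\int_{\mathbb R^d}f(v(x))h_k(x)\,dx=b_k$. -/

import Mathlib

namespace FlatPilipovic

noncomputable section

/-- Multi-indices in `ℕ₀^d`. -/
abbrev MultiIndex (d : ℕ) : Type := Fin d → ℕ

/-- The length `|n| = n₁ + ⋯ + n_d`. -/
def MultiIndex.len {d : ℕ} (n : MultiIndex d) : ℕ := ∑ i, n i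

/-- The factorial `n! = n₁! ⋯ n_d!`. -/
def MultiIndex.fact {d : ℕ} (n : MultiIndex d) : ℕ := ∏ i, (n i).factorial

/-- The multi-index `2n = (2n₁, …, 2n_d)`. -/
def MultiIndex.double {d : ℕ} (n : MultiIndex d) : MultiIndex d := fun i => 2 * n i

/-- The binomial coefficient `γ (γ - 1) ⋯ (γ - m + 1) / m!` with real upper entry. -/
def binom (γ : ℝ) (m : ℕ) : ℝ :=
  (∏ i ∈ Finset.range m, (γ - (i : ℝ))) / (m.factorial : ℝ)

/-- The multi-index binomial coefficient `∏ⱼ (γⱼ choose mⱼ)`. -/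
def multiBinom {d : ℕ} (γ : Fin d → ℝ) (m : MultiIndex d) : ℝ := ∏ j, binom (γ j) (m j)

/-- The Laguerre polynomial (of order `0`), by its Rodrigues formula
`L_n(x) = (e^x / n!) (d/dx)^n (e^{-x} x^n)`. -/
def laguerrePoly (n : ℕ) (x : ℝ) : ℝ :=
  Real.exp x / (n.factorial : ℝ) * iteratedDeriv n (fun t : ℝ => Real.exp (-t) * t ^ n) x

/-- The Laguerre function `l_n(x) = L_n(x) e^{-x/2}` of one variable. -/
def laguerreFun₁ (n : ℕ) (x : ℝ) : ℝ := laguerrePoly n x * Real.exp (-x / 2)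

/-- The Laguerre function `l_n(x) = l_{n₁}(x₁) ⋯ l_{n_d}(x_d)`. -/
def laguerreFun {d : ℕ} (n : MultiIndex d) (x : Fin d → ℝ) : ℝ := ∏ i, laguerreFun₁ (n i) (x i)

/-- The (physicists') Hermite polynomial `H_n(x) = (-1)^n e^{x²} (d/dx)^n (e^{-x²})`. -/
def hermitePoly (n : ℕ) (x : ℝ) : ℝ :=
  (-1) ^ n * Real.exp (x ^ 2) * iteratedDeriv n (fun t : ℝ => Real.exp (-t ^ 2)) x

/-- The Hermite function `h_n(x) = (2^n n! √π)^{-1/2} e^{-x²/2} H_n(x)` of one variable. -/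
def hermiteFun₁ (n : ℕ) (x : ℝ) : ℝ :=
  (Real.sqrt (2 ^ n * (n.factorial : ℝ) * Real.sqrt Real.pi))⁻¹
    * Real.exp (-x ^ 2 / 2) * hermitePoly n x

/-- The Hermite function `h_n(x) = h_{n₁}(x₁) ⋯ h_{n_d}(x_d)`. -/
def hermiteFun {d : ℕ} (n : MultiIndex d) (x : Fin d → ℝ) : ℝ := ∏ i, hermiteFun₁ (n i) (x i)

/-- The open orthant `ℝ^d_+ = (0, ∞)^d`. -/
def orthant (d : ℕ) : Set (Fin d → ℝ) := {x | ∀ i, 0 < x i}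

/-- The closed orthant `[0, ∞)^d`. -/
def closedOrthant (d : ℕ) : Set (Fin d → ℝ) := {x | ∀ i, 0 ≤ x i}

/-- The map `v(x) = (x₁², …, x_d²)`; it takes values in the closed orthant. -/
def v {d : ℕ} (x : Fin d → ℝ) : Fin d → ℝ := fun i => x i ^ 2

/-- The Laguerre coefficient `a_n(f) = ∫_{ℝ^d_+} f(x) l_n(x) dx`. -/
def laguerreCoeff {d : ℕ} (f : (Fin d → ℝ) → ℂ) (n : MultiIndex d) : ℂ :=
  ∫ x in orthant d, f x * (laguerreFun n x : ℂ)

/-- The Hermite coefficient `∫_{ℝ^d} g(x) h_n(x) dx`. -/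
def hermiteCoeff {d : ℕ} (g : (Fin d → ℝ) → ℂ) (n : MultiIndex d) : ℂ :=
  ∫ x, g x * (hermiteFun n x : ℂ)

/-- The weight `h^{|n|} (n!)^{1/(2σ)}`. -/
def flatWeight {d : ℕ} (h σ : ℝ) (n : MultiIndex d) : ℝ :=
  h ^ n.len * (n.fact : ℝ) ^ (1 / (2 * σ))

/-- The weighted space of the sequences with `sup_n |a_n| h^{|n|} (n!)^{1/(2σ)} < ∞`. -/
def flatSeqStep (d : ℕ) (h σ : ℝ) : Set (MultiIndex d → ℂ) :=
  {a | BddAbove (Set.range fun n : MultiIndex d => ‖a n‖ * flatWeight h σ n)}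

/-- The sequence space `ℓ_{♭σ}(ℕ₀^d)`, the union over `h > 0` of the weighted spaces. -/
def flatSeq (d : ℕ) (σ : ℝ) : Set (MultiIndex d → ℂ) :=
  ⋃ h ∈ Set.Ioi (0 : ℝ), flatSeqStep d h σ

/-- The space `𝒢_{♭σ}(ℝ^d_+)` of the sums `∑ a_n l_n` with `a ∈ ℓ_{♭(σ/2)}`. Its elements are
functions on the closed orthant; they are written as total functions, whose values off the
closed orthant are not constrained and play no role. -/
def flatG (d : ℕ) (σ : ℝ) : Set ((Fin d → ℝ) → ℂ) :=
  {f | ∃ a ∈ flatSeq d (σ / 2), ∀ x ∈ closedOrthant d,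
    HasSum (fun n : MultiIndex d => a n * (laguerreFun n x : ℂ)) (f x)}

/-- The space `ℋ_{♭σ}(ℝ^d)` of the sums `∑ a_n h_n` with `a ∈ ℓ_{♭σ}`. -/
def flatH (d : ℕ) (σ : ℝ) : Set ((Fin d → ℝ) → ℂ) :=
  {g | ∃ a ∈ flatSeq d σ, ∀ x,
    HasSum (fun n : MultiIndex d => a n * (hermiteFun n x : ℂ)) (g x)}

/-- The functions in `ℋ_{♭σ}(ℝ^d)` that are even in each variable. -/
def flatHEven (d : ℕ) (σ : ℝ) : Set ((Fin d → ℝ) → ℂ) :=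
  {g | g ∈ flatH d σ ∧ ∀ (x : Fin d → ℝ) (j : Fin d), g (Function.update x j (-x j)) = g x}

open Classical in
/-- The sequence indexed by all multi-indices whose entry at `2n` is `b n`, and whose entries at
the indices that are not of the form `2n` are `0`. -/
def evenExtend {d : ℕ} (b : MultiIndex d → ℂ) : MultiIndex d → ℂ :=
  fun k => if ∀ i, Even (k i) then b (fun i => k i / 2) else 0

/-- The terms `a_{k+n} (k - 1/2 choose k)` of the series in `evenCoeff`. -/
def evenCoeffTerm {d : ℕ} (a : MultiIndex d → ℂ) (n k : MultiIndex d) : ℂ :=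
  a (k + n) * (multiBinom (fun j => (k j : ℝ) - 1 / 2) k : ℂ)

/-- `b_{2n} = (-1)^{|n|} π^{d/4} √((2n)!) / (2^{|n|} n!) * ∑_k a_{k+n} (k - 1/2 choose k)`. -/
def evenCoeff {d : ℕ} (a : MultiIndex d → ℂ) (n : MultiIndex d) : ℂ :=
  (((-1) ^ n.len * Real.pi ^ ((d : ℝ) / 4) * Real.sqrt (n.double.fact : ℝ)
    / (2 ^ n.len * (n.fact : ℝ)) : ℝ) : ℂ) * ∑' k : MultiIndex d, evenCoeffTerm a n k

end

end FlatPilipovic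

/-! In one variable everything rests on `lag_comp_sq`: `L_n(x²) = ∑_{i+k=n} (k - 1/2 choose k)
E_i(x)` with `E_i = (-1)^i H_{2i} / (4^i i!)`. Both sides satisfy `F_{n+1}' = F_n' - 2x F_n`, so by
induction they differ by a constant, and at `0` this constant vanishes because the coefficients of
`(1-t)^{-1/2}` have a constant convolution square (`sum_antidiagonal_binom_half`).

Taking products over the variables and inserting this into `∑ a_m l_m(v x)` gives a double series
over pairs `(n, k)` with `n + k = m`. It converges absolutely (`summable_doubleTerm`): `a_{n+k}`
decays like a power of a factorial, `|E_i(x)| ≤ (3 + x²)^i`, and the binomials lie in `[0, 1]`.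
Summation along `n + k = m` returns `f(v x)`; summation over `k` first gives the Hermite series with
coefficients `b_{2n}`.

The decay of `b` follows from `(2n)! ≤ (2^n n!)²`. The coefficient formulas follow from
orthonormality and termwise integration (`integral_mul_of_hasSum_orthonormal`), for which `∑ |a_n| <
∞` is enough. -/

namespace FlatPilipovic

/-! ### Rodrigues formulas and recurrences for the Laguerre and Hermite polynomials. -/

open Polynomial Finset.HasAntidiagonal

/-- The polynomial `n! L_n`. -/
noncomputable def lagP : ℕ → ℝ[X]
  | 0 => 1
  | n + 1 => X * (derivative (lagP n) - lagP n) + ((n : ℝ[X]) + 1) * lagP n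

/-- The physicists' Hermite polynomial `H_n`. -/
noncomputable def hermP : ℕ → ℝ[X]
  | 0 => 1
  | n + 1 => 2 * X * hermP n - derivative (hermP n)

theorem lagP_succ (n : ℕ) :
    lagP (n + 1) = X * (derivative (lagP n) - lagP n) + ((n : ℝ[X]) + 1) * lagP n := rfl

theorem hermP_succ (n : ℕ) : hermP (n + 1) = 2 * X * hermP n - derivative (hermP n) := rfl

theorem iteratedDeriv_succ_id_mul {g : ℝ → ℝ} (hg : ContDiff ℝ ⊤ g) (n : ℕ) :
    iteratedDeriv (n + 1) (fun t => t * g t) =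
      fun t => t * iteratedDeriv (n + 1) g t + ((n : ℝ) + 1) * iteratedDeriv n g t := by
  have hd : ∀ m t, HasDerivAt (iteratedDeriv m g) (iteratedDeriv (m + 1) g t) t := fun m t => by
    rw [iteratedDeriv_succ]
    exact ((hg.differentiable_iteratedDeriv m (by exact_mod_cast WithTop.coe_lt_top _)) t).hasDerivAt
  induction n with
  | zero =>
    funext t
    rw [iteratedDeriv_succ, iteratedDeriv_zero]
    have := (hasDerivAt_id t).mul (hd 0 t)
    simp only [iteratedDeriv_zero] at this
    refine (this.deriv).trans ?_
    simp; ring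
  | succ n ih =>
    funext t
    rw [iteratedDeriv_succ, ih]
    refine (((hasDerivAt_id t).mul (hd (n + 1) t)).add ((hd n t).const_mul ((n : ℝ) + 1))).deriv.trans
      ?_
    simp; ring

/-- With `e^{-t} t^{n+1} = t · (e^{-t} t^n)` the Leibniz rule has only two terms; they are the
recursion defining `lagP`. -/
theorem iteratedDeriv_exp_neg_mul_pow (n : ℕ) :
    iteratedDeriv n (fun t : ℝ => Real.exp (-t) * t ^ n) =
      fun t => Real.exp (-t) * (lagP n).eval t := by
  induction n with
  | zero => funext t; simp [lagP]
  | succ n ih =>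
    have h1 : (fun t : ℝ => Real.exp (-t) * t ^ (n + 1)) =
        fun t => t * (Real.exp (-t) * t ^ n) := by funext t; ring
    rw [h1, iteratedDeriv_succ_id_mul (by fun_prop), iteratedDeriv_succ, ih]
    funext t
    have : HasDerivAt (fun t => Real.exp (-t) * (lagP n).eval t) _ t :=
      ((hasDerivAt_neg t).exp).mul ((lagP n).hasDerivAt t)
    rw [this.deriv, lagP_succ]
    simp; ring

theorem laguerrePoly_eq (n : ℕ) (x : ℝ) :
    laguerrePoly n x = (lagP n).eval x / n.factorial := by
  rw [laguerrePoly, iteratedDeriv_exp_neg_mul_pow, div_mul_eq_mul_div, ← mul_assoc,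
    ← Real.exp_add]
  simp

theorem iteratedDeriv_exp_neg_sq (n : ℕ) :
    iteratedDeriv n (fun t : ℝ => Real.exp (-t ^ 2)) =
      fun t => (-1) ^ n * Real.exp (-t ^ 2) * (hermP n).eval t := by
  induction n with
  | zero => funext t; simp [hermP]
  | succ n ih =>
    rw [iteratedDeriv_succ, ih]
    funext t
    have : HasDerivAt (fun t => (-1) ^ n * Real.exp (-t ^ 2) * (hermP n).eval t) _ t :=
      (((hasDerivAt_pow 2 t).neg.exp).const_mul ((-1 : ℝ) ^ n)).mul ((hermP n).hasDerivAt t)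
    rw [this.deriv, hermP_succ]
    simp; ring

theorem hermitePoly_eq (n : ℕ) (x : ℝ) : hermitePoly n x = (hermP n).eval x := by
  rw [hermitePoly, iteratedDeriv_exp_neg_sq]
  have h1 : (-1 : ℝ) ^ n * (-1) ^ n = 1 := by rw [← mul_pow]; simp
  have h2 : Real.exp (x ^ 2) * Real.exp (-x ^ 2) = 1 := by rw [← Real.exp_add]; simp
  linear_combination (hermP n).eval x * (Real.exp (x ^ 2) * Real.exp (-x ^ 2)) * h1
    + (hermP n).eval x * h2

/-- The two identities feed each other: the Laguerre equation at `n` gives the derivative relation,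
which gives the equation at `n + 1`. -/
theorem derivative_lagP_succ_and_ode (n : ℕ) :
    derivative (lagP (n + 1)) = ((n : ℝ[X]) + 1) * (derivative (lagP n) - lagP n) ∧
    X * derivative (derivative (lagP n)) + (1 - X) * derivative (lagP n)
      + (n : ℝ[X]) * lagP n = 0 := by
  have key : ∀ n : ℕ, X * derivative (derivative (lagP n)) + (1 - X) * derivative (lagP n)
      + (n : ℝ[X]) * lagP n = 0 →
      derivative (lagP (n + 1)) = ((n : ℝ[X]) + 1) * (derivative (lagP n) - lagP n) := by
    intro n h
    rw [lagP_succ]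
    simp only [derivative_add, derivative_mul, derivative_sub, derivative_X, derivative_natCast,
      derivative_one]
    linear_combination h
  suffices h : X * derivative (derivative (lagP n)) + (1 - X) * derivative (lagP n)
      + (n : ℝ[X]) * lagP n = 0 from ⟨key n h, h⟩
  induction n with
  | zero => simp [lagP]
  | succ n ih =>
    rw [key n ih, lagP_succ]
    simp only [derivative_add, derivative_mul, derivative_sub, derivative_natCast,
      derivative_one, Nat.cast_succ]
    linear_combination ((n : ℝ[X]) + 1) * ih

theorem derivative_lagP_succ (n : ℕ) :
    derivative (lagP (n + 1)) = ((n : ℝ[X]) + 1) * (derivative (lagP n) - lagP n) :=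
  (derivative_lagP_succ_and_ode n).1

theorem derivative_hermP_succ (n : ℕ) :
    derivative (hermP (n + 1)) = 2 * ((n : ℝ[X]) + 1) * hermP n := by
  induction n with
  | zero => simp [hermP]
  | succ n ih =>
    have h2 : derivative (2 : ℝ[X]) = 0 := derivative_ofNat 2
    rw [hermP_succ (n + 1)]
    simp only [derivative_mul, derivative_sub, derivative_X, h2, ih, derivative_add,
      derivative_natCast, derivative_one]
    push_cast
    linear_combination (-2 * ((n : ℝ[X]) + 1)) * hermP_succ n

theorem hermP_succ_succ (n : ℕ) :
    hermP (n + 2) = 2 * X * hermP (n + 1) - 2 * ((n : ℝ[X]) + 1) * hermP n := by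
  rw [hermP_succ (n + 1), derivative_hermP_succ]

/-- The Laguerre polynomial `L_n`. -/
noncomputable def lag (n : ℕ) : ℝ[X] := C (n.factorial : ℝ)⁻¹ * lagP n

theorem laguerrePoly_eq_eval (n : ℕ) (x : ℝ) : laguerrePoly n x = (lag n).eval x := by
  rw [laguerrePoly_eq, lag, eval_mul, eval_C, div_eq_inv_mul]

theorem lag_zero : lag 0 = 1 := by simp [lag, lagP]

theorem lagP_eq (n : ℕ) : lagP n = C (n.factorial : ℝ) * lag n := by
  rw [lag, ← mul_assoc, ← C_mul, mul_inv_cancel₀ (by positivity), C_1, one_mul]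

theorem derivative_lag_succ (n : ℕ) :
    derivative (lag (n + 1)) = derivative (lag n) - lag n := by
  have h := derivative_lagP_succ n
  rw [lagP_eq, lagP_eq n, Nat.factorial_succ] at h
  simp only [derivative_C_mul] at h
  simp only [Nat.cast_mul, Nat.cast_succ, C_mul, C_add, C_1, map_natCast] at h
  have h0 : ((n : ℝ[X]) + 1) * (n.factorial : ℝ[X]) ≠ 0 := by
    exact_mod_cast (by positivity : (n + 1) * n.factorial ≠ 0)
  apply mul_left_cancel₀ h0
  linear_combination h

theorem succ_mul_lag_succ (n : ℕ) :
    ((n : ℝ[X]) + 1) * lag (n + 1) = X * (derivative (lag n) - lag n)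
      + ((n : ℝ[X]) + 1) * lag n := by
  have h := lagP_succ n
  rw [lagP_eq, lagP_eq n, Nat.factorial_succ] at h
  simp only [derivative_C_mul] at h
  simp only [Nat.cast_mul, Nat.cast_succ, C_mul, C_add, C_1, map_natCast] at h
  have h0 : (n.factorial : ℝ[X]) ≠ 0 := by
    exact_mod_cast n.factorial_ne_zero
  apply mul_left_cancel₀ h0
  linear_combination h

/-- Derivatives are eliminated between two consecutive instances of `succ_mul_lag_succ`. At `n = 0`
the truncated index `n - 1` is harmless, since its coefficient is `0`. -/
theorem lag_recurrence (n : ℕ) :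
    X * lag n = (2 * (n : ℝ[X]) + 1) * lag n - ((n : ℝ[X]) + 1) * lag (n + 1)
      - (n : ℝ[X]) * lag (n - 1) := by
  cases n with
  | zero =>
    have := succ_mul_lag_succ 0
    simp only [lag_zero, derivative_one] at this ⊢
    push_cast at this ⊢
    linear_combination this
  | succ n =>
    have h1 := succ_mul_lag_succ (n + 1)
    have h2 := succ_mul_lag_succ n
    have h3 := derivative_lag_succ n
    rw [Nat.add_sub_cancel]
    push_cast at h1 ⊢
    linear_combination h1 + X * h3 - h2

theorem lag_eval_zero (n : ℕ) : (lag n).eval 0 = 1 := by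
  induction n with
  | zero => simp [lag_zero]
  | succ n ih =>
    have := congrArg (eval 0) (succ_mul_lag_succ n)
    simp [ih] at this
    have h0 : (n : ℝ) + 1 ≠ 0 := by positivity
    exact mul_left_cancel₀ h0 (by rw [this, mul_one])

/-! ### Expansion of `L_n(x²)` in even Hermite polynomials. -/

/-- The polynomial `(-1)^i H_{2i} / (4^i i!)`, equal to `L_i^{(-1/2)}(x²)`. -/
noncomputable def evenHerm (i : ℕ) : ℝ[X] :=
  C ((-1) ^ i / (4 ^ i * (i.factorial : ℝ))) * hermP (2 * i)

theorem evenHerm_zero : evenHerm 0 = 1 := by simp [evenHerm, hermP]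

theorem hermP_double (i : ℕ) : hermP (2 * i) = C ((-1) ^ i * 4 ^ i * (i.factorial : ℝ)) * evenHerm i := by
  rw [evenHerm, ← mul_assoc, ← C_mul]
  have : (-1 : ℝ) ^ i * (-1) ^ i = 1 := by rw [← mul_pow]; simp
  have h : (-1 : ℝ) ^ i * 4 ^ i * (i.factorial : ℝ) * ((-1) ^ i / (4 ^ i * i.factorial)) = 1 := by
    field_simp
    rw [← pow_mul, mul_comm, pow_mul]; simp
  rw [h]; simp

/-- This is the relation that `L_i(x²)` satisfies as well, which is what makes the comparison in
`lag_comp_sq` possible. -/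
theorem derivative_evenHerm_succ (i : ℕ) :
    derivative (evenHerm (i + 1)) = derivative (evenHerm i) - 2 * X * evenHerm i := by
  have hC : C ((-1) ^ (i + 1) / (4 ^ (i + 1) * ((i + 1).factorial : ℝ))) * (4 * ((i : ℝ[X]) + 1)) =
      - C ((-1) ^ i / (4 ^ i * (i.factorial : ℝ))) := by
    rw [← C_neg, ← map_natCast C, ← C_1, ← C_add, ← C_ofNat 4, ← C_mul, ← C_mul]
    congr 1
    rw [Nat.factorial_succ]; push_cast; field_simp; ring
  have h1 : derivative (hermP (2 * (i + 1))) = 4 * ((i : ℝ[X]) + 1) * hermP (2 * i + 1) := by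
    rw [show 2 * (i + 1) = (2 * i + 1) + 1 by ring, derivative_hermP_succ]; push_cast; ring
  rw [evenHerm, evenHerm, derivative_C_mul, derivative_C_mul, h1, ← mul_assoc, hC, hermP_succ]
  ring

theorem eval_hermP_double (i : ℕ) (x : ℝ) :
    (hermP (2 * i)).eval x = (-1) ^ i * 4 ^ i * (i.factorial : ℝ) * (evenHerm i).eval x := by
  rw [hermP_double, eval_mul, eval_C]

theorem eval_evenHerm_one (x : ℝ) : (evenHerm 1).eval x = 1 / 2 - x ^ 2 := by
  simp [evenHerm, hermP]
  ring

/-- Three consecutive Hermite recurrences, with the odd-degree polynomials eliminated. -/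
theorem evenHerm_succ (i : ℕ) (x : ℝ) :
    ((i : ℝ) + 1 + 1) * (evenHerm (i + 2)).eval x =
      (2 * (i + 1) + 1 / 2 - x ^ 2) * (evenHerm (i + 1)).eval x
      - (i + 1 - 1 / 2) * (evenHerm i).eval x := by
  have e1 := congrArg (eval x) (hermP_succ_succ (2 * i))
  have e2 := congrArg (eval x) (hermP_succ_succ (2 * i + 1))
  have e3 := congrArg (eval x) (hermP_succ_succ (2 * i + 2))
  rw [show 2 * i + 2 = 2 * (i + 1) by ring] at e1 e3
  rw [show 2 * i + 1 + 2 = 2 * (i + 1) + 1 by ring, show 2 * i + 1 + 1 = 2 * (i + 1) by ring]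
    at e2
  rw [show 2 * (i + 1) + 2 = 2 * (i + 2) by ring] at e3
  simp only [eval_sub, eval_mul, eval_ofNat, eval_X, eval_add, eval_natCast, eval_one,
    eval_hermP_double, Nat.factorial_succ, Nat.cast_mul, Nat.cast_add, Nat.cast_ofNat,
    Nat.cast_one] at e1 e2 e3
  have h0 : (-1 : ℝ) ^ i * 4 ^ i * (i.factorial : ℝ) * 16 * (i + 1) ≠ 0 := by
    positivity
  apply mul_left_cancel₀ h0
  linear_combination e3 + 2 * x * e2 + 4 * (i + 1) * e1

/-- A crude bound, exponential in `i`, suffices against factorial decay. The constant `3` closes the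
induction because `(2 + t)(3 + t) + 1 ≤ (3 + t)²` for `t = x²`. -/
theorem abs_evenHerm_le (i : ℕ) (x : ℝ) : |(evenHerm i).eval x| ≤ (3 + x ^ 2) ^ i := by
  have hx := sq_nonneg x
  suffices h : |(evenHerm i).eval x| ≤ (3 + x ^ 2) ^ i ∧
      |(evenHerm (i + 1)).eval x| ≤ (3 + x ^ 2) ^ (i + 1) from h.1
  induction i with
  | zero =>
    refine ⟨by simp [evenHerm_zero], ?_⟩
    simp only [zero_add, eval_evenHerm_one, pow_one, abs_le]
    constructor <;> linarith
  | succ i ih =>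
    refine ⟨ih.2, ?_⟩
    have h := evenHerm_succ i x
    obtain ⟨h1, h2⟩ := ih
    set A := (evenHerm i).eval x
    set B := (evenHerm (i + 1)).eval x
    set K := (3 + x ^ 2) ^ i
    have hK : 0 ≤ K := by positivity
    have hi : (0 : ℝ) ≤ i := by positivity
    have h3 : ((i : ℝ) + 1 + 1) * |(evenHerm (i + 1 + 1)).eval x| ≤
        (2 * (i + 1) + 1 / 2 + x ^ 2) * |B| + (i + 1) * |A| := by
      rw [← abs_of_nonneg (by positivity : (0 : ℝ) ≤ (i : ℝ) + 1 + 1), ← abs_mul, h]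
      refine (abs_sub _ _).trans ?_
      rw [abs_mul, abs_mul]
      gcongr
      · rw [abs_le]; constructor <;> linarith
      · rw [abs_le]; constructor <;> linarith
    have h4 : (2 * (i + 1) + 1 / 2 + x ^ 2) * |B| + (i + 1) * |A| ≤
        ((i : ℝ) + 1 + 1) * ((2 + x ^ 2) * ((3 + x ^ 2) * K) + K) := by
      rw [pow_succ'] at h2
      calc _ ≤ (2 * ((i : ℝ) + 1) + 1 / 2 + x ^ 2) * ((3 + x ^ 2) * K) + (i + 1) * K := by gcongr
        _ ≤ ((i : ℝ) + 1 + 1) * (2 + x ^ 2) * ((3 + x ^ 2) * K) + ((i : ℝ) + 1 + 1) * K := by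
          gcongr
          · nlinarith
          · linarith
        _ = _ := by ring
    have h5 := le_of_mul_le_mul_left (h3.trans h4) (by positivity)
    refine h5.trans ?_
    rw [pow_succ' _ (i + 1), pow_succ' _ i, show (3 + x ^ 2) ^ i = K from rfl]
    nlinarith [mul_nonneg hK hx]

theorem binom_half_succ (k : ℕ) :
    ((k : ℝ) + 1) * binom ((k + 1 : ℕ) - 1 / 2) (k + 1) = (k + 1 / 2) * binom (k - 1 / 2) k := by
  simp only [binom]
  rw [Finset.prod_range_succ', Nat.factorial_succ]
  have : ∀ i ∈ Finset.range k, (((k + 1 : ℕ) : ℝ) - 1 / 2 - ((i + 1 : ℕ) : ℝ)) = k - 1 / 2 - i := by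
    intro i _; push_cast; ring
  rw [Finset.prod_congr rfl this]
  push_cast
  field_simp
  ring

theorem binom_half_zero : binom ((0 : ℕ) - 1 / 2) 0 = 1 := by simp [binom]

theorem binom_half_mem (k : ℕ) : 0 ≤ binom (k - 1 / 2) k ∧ binom (k - 1 / 2) k ≤ 1 := by
  induction k with
  | zero => rw [binom_half_zero]; simp
  | succ k ih =>
    have h := binom_half_succ k
    have hk : (0 : ℝ) < (k : ℝ) + 1 := by positivity
    have h' : binom ((k + 1 : ℕ) - 1 / 2) (k + 1) = (k + 1 / 2) * binom (k - 1 / 2) k / (k + 1) := by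
      rw [← h]; field_simp
    rw [h']
    refine ⟨div_nonneg (mul_nonneg (by positivity) ih.1) hk.le, ?_⟩
    rw [div_le_one hk]
    nlinarith [ih.1, ih.2]

theorem evenHerm_eval_zero (i : ℕ) : (evenHerm i).eval 0 = binom (i - 1 / 2) i := by
  induction i with
  | zero => rw [binom_half_zero]; simp [evenHerm_zero]
  | succ i ih =>
    have h1 : (hermP (2 * (i + 1))).eval 0 = -2 * (2 * i + 1) * (hermP (2 * i)).eval 0 := by
      have := congrArg (eval 0) (hermP_succ_succ (2 * i))
      simp at this
      rw [mul_add, mul_one, this]; ring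
    rw [eval_hermP_double, eval_hermP_double, Nat.factorial_succ] at h1
    have h0 : (-1 : ℝ) ^ i * 4 ^ i * (i.factorial : ℝ) * 4 ≠ 0 := by positivity
    have hk : (0 : ℝ) < (i : ℝ) + 1 := by positivity
    apply mul_left_cancel₀ hk.ne'
    rw [binom_half_succ, ← ih]
    apply mul_left_cancel₀ h0
    push_cast at h1
    linear_combination -h1

/-- The convolution square of the sequence `(k - 1/2 choose k)` is constant. -/
theorem sum_antidiagonal_binom_half (n : ℕ) :
    ∑ p ∈ antidiagonal n, binom (p.1 - 1 / 2) p.1 * binom (p.2 - 1 / 2) p.2 = 1 := by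
  -- Coefficient form of `((1-t)^{-1/2})² = (1-t)^{-1}`. Swapping `p.1` and `p.2` shows that the
  -- weight `p.1` amounts to `n / 2`; with `binom_half_succ` the sums `S` then satisfy `(n+1)/2 · S
  -- (n+1) = (n+1)/2 · S n`.
  have hS : ∀ n : ℕ, ∑ p ∈ antidiagonal n,
        (p.1 : ℝ) * (binom (p.1 - 1 / 2) p.1 * binom (p.2 - 1 / 2) p.2) =
      n / 2 * ∑ p ∈ antidiagonal n, binom (p.1 - 1 / 2) p.1 * binom (p.2 - 1 / 2) p.2 := by
    intro n
    have hsym := Finset.Nat.sum_antidiagonal_swap (n := n) (f := fun p : ℕ × ℕ =>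
      (p.1 : ℝ) * (binom (p.1 - 1 / 2) p.1 * binom (p.2 - 1 / 2) p.2))
    have hadd : ∑ p ∈ antidiagonal n,
          (p.1 : ℝ) * (binom (p.1 - 1 / 2) p.1 * binom (p.2 - 1 / 2) p.2) +
        ∑ p ∈ antidiagonal n,
          (p.2 : ℝ) * (binom (p.2 - 1 / 2) p.2 * binom (p.1 - 1 / 2) p.1) =
        n * ∑ p ∈ antidiagonal n, binom (p.1 - 1 / 2) p.1 * binom (p.2 - 1 / 2) p.2 := by
      rw [← Finset.sum_add_distrib, Finset.mul_sum]
      refine Finset.sum_congr rfl fun p hp => ?_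
      rw [← Finset.HasAntidiagonal.mem_antidiagonal.1 hp]
      push_cast; ring
    simp only [Prod.fst_swap, Prod.snd_swap] at hsym
    rw [hsym] at hadd
    linarith
  induction n with
  | zero => simp [binom]
  | succ n ih =>
    have h := hS (n + 1)
    rw [Finset.Nat.sum_antidiagonal_succ] at h
    have h2 : ∑ p ∈ antidiagonal n, ((p.1 + 1 : ℕ) : ℝ) *
        (binom ((p.1 + 1 : ℕ) - 1 / 2) (p.1 + 1) * binom (p.2 - 1 / 2) p.2) =
        ∑ p ∈ antidiagonal n, ((p.1 : ℝ) *
          (binom (p.1 - 1 / 2) p.1 * binom (p.2 - 1 / 2) p.2) +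
          1 / 2 * (binom (p.1 - 1 / 2) p.1 * binom (p.2 - 1 / 2) p.2)) := by
      refine Finset.sum_congr rfl fun p _ => ?_
      rw [← mul_assoc, Nat.cast_succ]
      have := binom_half_succ p.1
      rw [Nat.cast_succ] at this
      rw [this]; ring
    simp only at h
    rw [h2, Finset.sum_add_distrib, hS, ← Finset.mul_sum, ih] at h
    have hk : (0 : ℝ) < ((n : ℝ) + 1) / 2 := by positivity
    apply mul_left_cancel₀ hk.ne'
    push_cast at h ⊢
    linarith

/-- Expansion of the Laguerre polynomials, at `x²`, in the even Hermite polynomials. -/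
theorem lag_comp_sq (n : ℕ) :
    (lag n).comp (X ^ 2) =
      ∑ p ∈ antidiagonal n, C (binom (p.2 - 1 / 2) p.2) * evenHerm p.1 := by
  induction n with
  | zero => simp [lag_zero, evenHerm_zero, binom]
  | succ n ih =>
    -- Equality of derivatives first; on the right the term with `p.1 = 0` is constant and drops
    -- out. Evaluation at `0` then fixes the constant.
    have hd : derivative ((lag (n + 1)).comp (X ^ 2)) = derivative
        (∑ p ∈ antidiagonal (n + 1), C (binom (p.2 - 1 / 2) p.2) * evenHerm p.1) := by
      have h1 : derivative ((lag (n + 1)).comp (X ^ 2)) =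
          derivative ((lag n).comp (X ^ 2)) - 2 * X * (lag n).comp (X ^ 2) := by
        rw [derivative_comp, derivative_comp, derivative_lag_succ, sub_comp, derivative_X_sq,
          C_ofNat]
        ring
      rw [h1, ih, Finset.Nat.sum_antidiagonal_succ, derivative_add, derivative_sum,
        derivative_sum, Finset.mul_sum, ← Finset.sum_sub_distrib]
      simp only [derivative_C_mul, evenHerm_zero, derivative_one, mul_zero, zero_add,
        derivative_evenHerm_succ]
      refine Finset.sum_congr rfl fun p _ => ?_
      ring
    have h0 : derivative ((lag (n + 1)).comp (X ^ 2) -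
        ∑ p ∈ antidiagonal (n + 1), C (binom (p.2 - 1 / 2) p.2) * evenHerm p.1) = 0 := by
      rw [derivative_sub, hd, sub_self]
    have h1 := eq_C_of_derivative_eq_zero h0
    have h2 : eval 0 ((lag (n + 1)).comp (X ^ 2) -
        ∑ p ∈ antidiagonal (n + 1), C (binom (p.2 - 1 / 2) p.2) * evenHerm p.1) = 0 := by
      simp only [eval_sub, eval_comp, eval_pow, eval_X, eval_finsetSum, eval_mul, eval_C,
        evenHerm_eval_zero]
      rw [zero_pow two_ne_zero, lag_eval_zero, sub_eq_zero]
      refine (sum_antidiagonal_binom_half (n + 1)).symm.trans ?_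
      exact Finset.sum_congr rfl fun p _ => mul_comm _ _
    rw [h1, eval_C] at h2
    rw [h2, C_0] at h1
    exact sub_eq_zero.1 h1

end FlatPilipovic

/-! ### Orthonormality of the Laguerre and Hermite functions in one variable. -/

namespace FlatPilipovic

open Polynomial MeasureTheory Set

theorem integrableOn_eval_mul_exp_neg (p : ℝ[X]) :
    IntegrableOn (fun x : ℝ => p.eval x * Real.exp (-x)) (Ioi 0) := by
  induction p using Polynomial.induction_on' with
  | add p q hp hq => simp only [eval_add, add_mul]; exact hp.add hq
  | monomial n a =>
    have h := Real.GammaIntegral_convergent (s := (n : ℝ) + 1) (by positivity)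
    simp only [add_sub_cancel_right, Real.rpow_natCast] at h
    refine (h.const_mul a).congr (Filter.Eventually.of_forall fun x => ?_)
    simp only [eval_monomial]
    ring

/-- The functional `p ↦ ∫₀^∞ p(x) e^{-x} dx`. -/
noncomputable def expInt : ℝ[X] →ₗ[ℝ] ℝ where
  toFun p := ∫ x in Ioi (0 : ℝ), p.eval x * Real.exp (-x)
  map_add' p q := by
    simp only [eval_add, add_mul]
    exact integral_add (integrableOn_eval_mul_exp_neg p) (integrableOn_eval_mul_exp_neg q)
  map_smul' a p := by
    simp only [eval_smul, smul_eq_mul, mul_assoc, RingHom.id_apply]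
    exact integral_const_mul _ _

theorem expInt_apply (p : ℝ[X]) :
    expInt p = ∫ x in Ioi (0 : ℝ), p.eval x * Real.exp (-x) := rfl

theorem expInt_derivative_sub (p : ℝ[X]) : expInt (derivative p - p) = -p.eval 0 := by
  have hd : ∀ x ∈ Ici (0 : ℝ), HasDerivAt (fun x => p.eval x * Real.exp (-x))
      ((derivative p - p).eval x * Real.exp (-x)) x := fun x _ => by
    refine ((p.hasDerivAt x).mul ((hasDerivAt_neg x).exp)).congr_deriv ?_
    rw [eval_sub]; ring
  have ht : Filter.Tendsto (fun x => p.eval x * Real.exp (-x)) Filter.atTop (nhds 0) := by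
    simpa only [Real.exp_neg, div_eq_mul_inv] using p.tendsto_div_exp_atTop
  rw [expInt_apply, integral_Ioi_of_hasDerivAt_of_tendsto' hd (integrableOn_eval_mul_exp_neg _) ht]
  simp

/-- `expInt (p' - p) = -1` for both `p = L_n` and `p = L_{n+1}`; since `L_{n+1}' = L_n' - L_n`, the
difference is the integral of `L_{n+1}`. -/
theorem expInt_lag (n : ℕ) : expInt (lag n) = if n = 0 then 1 else 0 := by
  cases n with
  | zero =>
    have := expInt_derivative_sub (lag 0)
    rw [lag_eval_zero, lag_zero, derivative_one, zero_sub, map_neg] at this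
    rw [lag_zero, if_pos rfl, neg_injective this]
  | succ n =>
    have h1 := expInt_derivative_sub (lag (n + 1))
    have h2 := expInt_derivative_sub (lag n)
    rw [derivative_lag_succ, map_sub, h2, lag_eval_zero, lag_eval_zero] at h1
    rw [if_neg n.succ_ne_zero]
    linarith

theorem expInt_lag_mul_lag (n m : ℕ) : expInt (lag n * lag m) = if n = m then 1 else 0 := by
  have hc : ∀ (c : ℕ) (p : ℝ[X]), expInt ((c : ℝ[X]) * p) = c * expInt p := fun c p => by
    rw [← nsmul_eq_mul, map_nsmul, nsmul_eq_mul]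
  induction n using Nat.strong_induction_on generalizing m with
  | _ n ih =>
    cases n with
    | zero =>
      rw [lag_zero, one_mul, expInt_lag]
      simp only [eq_comm]
    | succ n =>
      -- `X L_n L_m` is expanded by the recurrence for `L_n` and by that for `L_m`. This lowers the
      -- first index at the price of moving `m`, hence the induction on `n` for all `m`.
      have h : ((n + 1 : ℕ) : ℝ[X]) * (lag (n + 1) * lag m) =
          ((2 * n + 1 : ℕ) : ℝ[X]) * (lag n * lag m) - (n : ℝ[X]) * (lag (n - 1) * lag m)
          - (((2 * m + 1 : ℕ) : ℝ[X]) * (lag n * lag m)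
            - ((m + 1 : ℕ) : ℝ[X]) * (lag n * lag (m + 1))
            - (m : ℝ[X]) * (lag n * lag (m - 1))) := by
        push_cast
        linear_combination lag m * lag_recurrence n - lag n * lag_recurrence m
      have h' := congrArg expInt h
      simp only [map_sub, hc] at h'
      rw [ih n n.lt_succ_self, ih n n.lt_succ_self, ih n n.lt_succ_self,
        ih (n - 1) (by omega)] at h'
      have hn : ((n + 1 : ℕ) : ℝ) ≠ 0 := by positivity
      apply mul_left_cancel₀ hn
      rw [h']
      rcases lt_trichotomy (n + 1) m with h1 | h1 | h1
      · simp [show n ≠ m by omega, show n - 1 ≠ m by omega, show n ≠ m + 1 by omega,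
          show n ≠ m - 1 by omega, show n + 1 ≠ m by omega]
      · subst h1
        simp
        omega
      · rcases eq_or_ne n m with h2 | h2
        · subst h2
          rcases n with _ | n <;> simp
        · rcases eq_or_ne n (m + 1) with h3 | h3
          · subst h3
            simp [show m + 1 ≠ m - 1 by omega, show m + 1 + 1 ≠ m by omega]
          · simp [h2, h3, show n - 1 ≠ m by omega, show n ≠ m - 1 by omega,
              show n + 1 ≠ m by omega]

theorem integrable_eval_mul_exp_neg_sq (p : ℝ[X]) :
    Integrable (fun x : ℝ => p.eval x * Real.exp (-x ^ 2)) := by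
  induction p using Polynomial.induction_on' with
  | add p q hp hq => simp only [eval_add, add_mul]; exact hp.add hq
  | monomial n a =>
    have h := integrable_rpow_mul_exp_neg_mul_sq (b := 1) one_pos (s := n)
      (by have : (0 : ℝ) ≤ n := by positivity
          linarith)
    simp only [Real.rpow_natCast] at h
    refine (h.const_mul a).congr (Filter.Eventually.of_forall fun x => ?_)
    simp only [eval_monomial, neg_mul, one_mul]
    ring

/-- Integration by parts, from `(H_n e^{-x²})' = -H_{n+1} e^{-x²}`. -/
theorem integral_hermP_succ_mul (n : ℕ) (q : ℝ[X]) :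
    ∫ x : ℝ, (hermP (n + 1) * q).eval x * Real.exp (-x ^ 2) =
      ∫ x : ℝ, (hermP n * derivative q).eval x * Real.exp (-x ^ 2) := by
  have hd : ∀ x : ℝ, HasDerivAt (fun x => (hermP n * q).eval x * Real.exp (-x ^ 2))
      ((hermP n * derivative q).eval x * Real.exp (-x ^ 2)
        - (hermP (n + 1) * q).eval x * Real.exp (-x ^ 2)) x := fun x => by
    refine (((hermP n * q).hasDerivAt x).mul ((hasDerivAt_pow 2 x).neg.exp)).congr_deriv ?_
    rw [hermP_succ]
    simp
    ring
  have h := integral_eq_zero_of_hasDerivAt_of_integrable hd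
    ((integrable_eval_mul_exp_neg_sq _).sub (integrable_eval_mul_exp_neg_sq _))
    (integrable_eval_mul_exp_neg_sq _)
  rw [integral_sub (integrable_eval_mul_exp_neg_sq _) (integrable_eval_mul_exp_neg_sq _)] at h
  linarith

theorem integral_hermP_mul_hermP (n m : ℕ) :
    ∫ x : ℝ, (hermP n * hermP m).eval x * Real.exp (-x ^ 2) =
      if n = m then 2 ^ n * (n.factorial : ℝ) * Real.sqrt Real.pi else 0 := by
  induction n generalizing m with
  | zero =>
    cases m with
    | zero =>
      have := integral_gaussian 1
      simpa [hermP] using this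
    | succ m =>
      rw [mul_comm, integral_hermP_succ_mul]
      simp [hermP]
  | succ n ih =>
    rw [integral_hermP_succ_mul]
    cases m with
    | zero => simp [hermP]
    | succ m =>
      rw [derivative_hermP_succ]
      have : ∀ x : ℝ, (hermP n * (2 * ((m : ℝ[X]) + 1) * hermP m)).eval x * Real.exp (-x ^ 2) =
          2 * ((m : ℝ) + 1) * ((hermP n * hermP m).eval x * Real.exp (-x ^ 2)) := fun x => by
        simp; ring
      simp only [this]
      rw [integral_const_mul, ih]
      by_cases h : n = m
      · subst h
        simp [Nat.factorial_succ]; ring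
      · simp [h]

theorem laguerreFun₁_mul (n m : ℕ) (x : ℝ) :
    laguerreFun₁ n x * laguerreFun₁ m x = (lag n * lag m).eval x * Real.exp (-x) := by
  have : Real.exp (-x) = Real.exp (-x / 2) * Real.exp (-x / 2) := by
    rw [← Real.exp_add]; ring_nf
  rw [laguerreFun₁, laguerreFun₁, laguerrePoly_eq_eval, laguerrePoly_eq_eval, eval_mul, this]
  ring

theorem integrableOn_laguerreFun₁_mul (n m : ℕ) :
    IntegrableOn (fun x => laguerreFun₁ n x * laguerreFun₁ m x) (Ioi 0) := by
  simp only [laguerreFun₁_mul]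
  exact integrableOn_eval_mul_exp_neg _

theorem integral_laguerreFun₁_mul (n m : ℕ) :
    ∫ x in Ioi (0 : ℝ), laguerreFun₁ n x * laguerreFun₁ m x = if n = m then 1 else 0 := by
  simp only [laguerreFun₁_mul]
  exact expInt_lag_mul_lag n m

theorem hermiteFun₁_mul (n m : ℕ) (x : ℝ) :
    hermiteFun₁ n x * hermiteFun₁ m x =
      ((Real.sqrt (2 ^ n * (n.factorial : ℝ) * Real.sqrt Real.pi))⁻¹ *
        (Real.sqrt (2 ^ m * (m.factorial : ℝ) * Real.sqrt Real.pi))⁻¹) *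
      ((hermP n * hermP m).eval x * Real.exp (-x ^ 2)) := by
  have : Real.exp (-x ^ 2) = Real.exp (-x ^ 2 / 2) * Real.exp (-x ^ 2 / 2) := by
    rw [← Real.exp_add]; ring_nf
  rw [hermiteFun₁, hermiteFun₁, hermitePoly_eq, hermitePoly_eq, eval_mul, this]
  ring

theorem integrable_hermiteFun₁_mul (n m : ℕ) :
    Integrable (fun x => hermiteFun₁ n x * hermiteFun₁ m x) := by
  simp only [hermiteFun₁_mul]
  exact (integrable_eval_mul_exp_neg_sq _).const_mul _

theorem integral_hermiteFun₁_mul (n m : ℕ) :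
    ∫ x, hermiteFun₁ n x * hermiteFun₁ m x = if n = m then 1 else 0 := by
  simp only [hermiteFun₁_mul]
  rw [integral_const_mul, integral_hermP_mul_hermP]
  by_cases h : n = m
  · subst h
    have h0 : (0 : ℝ) < 2 ^ n * (n.factorial : ℝ) * Real.sqrt Real.pi := by positivity
    rw [if_pos rfl, if_pos rfl, ← mul_inv, Real.mul_self_sqrt h0.le, inv_mul_cancel₀ h0.ne']
  · simp [h]

/-- The Laguerre function at `x²`, expanded in even Hermite polynomials. -/
theorem laguerreFun₁_sq (n : ℕ) (x : ℝ) :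
    laguerreFun₁ n (x ^ 2) = ∑ p ∈ Finset.HasAntidiagonal.antidiagonal n,
      binom (p.2 - 1 / 2) p.2 * ((evenHerm p.1).eval x * Real.exp (-x ^ 2 / 2)) := by
  have h := congrArg (eval x) (lag_comp_sq n)
  rw [eval_comp, eval_pow, eval_X, eval_finsetSum] at h
  rw [laguerreFun₁, laguerrePoly_eq_eval, h, Finset.sum_mul]
  simp only [eval_mul, eval_C, mul_assoc]

/-- The normalization of `h_{2n}` produces here the one-variable factor in front of the series for
`b_{2n}`. -/
theorem evenHerm_mul_exp (n : ℕ) (x : ℝ) :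
    (evenHerm n).eval x * Real.exp (-x ^ 2 / 2) =
      (-1) ^ n * Real.pi ^ ((1 : ℝ) / 4) * Real.sqrt ((2 * n).factorial : ℝ)
        / (2 ^ n * (n.factorial : ℝ)) * hermiteFun₁ (2 * n) x := by
  have h1 : Real.sqrt (2 ^ (2 * n) * ((2 * n).factorial : ℝ) * Real.sqrt Real.pi) =
      2 ^ n * Real.sqrt ((2 * n).factorial : ℝ) * Real.pi ^ ((1 : ℝ) / 4) := by
    rw [Real.sqrt_mul (by positivity), Real.sqrt_mul (by positivity), mul_comm 2 n, pow_mul,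
      Real.sqrt_sq (by positivity), Real.sqrt_eq_rpow (Real.sqrt Real.pi), Real.sqrt_eq_rpow Real.pi,
      ← Real.rpow_mul Real.pi_pos.le]
    norm_num
  have h2 : (0 : ℝ) < Real.pi ^ ((1 : ℝ) / 4) := by positivity
  have h3 : (0 : ℝ) < Real.sqrt ((2 * n).factorial : ℝ) := by positivity
  have h4 : (4 : ℝ) ^ n = 2 ^ n * 2 ^ n := by rw [← mul_pow]; norm_num
  rw [hermiteFun₁, h1, evenHerm, hermitePoly_eq, eval_mul, eval_C, h4]
  field_simp

end FlatPilipovic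

/-! ### Coefficients by termwise integration, and the passage to several variables. -/

namespace FlatPilipovic

open MeasureTheory Set Filter

section Orthonormal

variable {α ι : Type*} [MeasurableSpace α] {μ : Measure α} [Countable ι]

theorem integrable_of_hasSum_of_summable_integral_norm {F : ι → α → ℂ} {g : α → ℂ}
    (hF : ∀ i, Integrable (F i) μ) (hs : Summable fun i => ∫ x, ‖F i x‖ ∂μ)
    (hg : ∀ᵐ x ∂μ, HasSum (fun i => F i x) (g x)) : Integrable g μ := by
  refine ⟨aestronglyMeasurable_of_tendsto_ae (atTop : Filter (Finset ι))
    (f := fun s x => ∑ i ∈ s, F i x)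
    (fun s => Finset.aestronglyMeasurable_fun_sum s fun i _ => (hF i).1) hg, ?_⟩
  have h1 : ∫⁻ x, ‖g x‖ₑ ∂μ ≤ ∑' i, ∫⁻ x, ‖F i x‖ₑ ∂μ := by
    rw [← lintegral_tsum fun i => (hF i).1.enorm]
    refine lintegral_mono_ae (hg.mono fun x hx => ?_)
    rw [← hx.tsum_eq]
    exact enorm_tsum_le_tsum_enorm
  refine h1.trans_lt (lt_top_iff_ne_top.2 ?_)
  have h2 : ∀ i, ∫⁻ x, ‖F i x‖ₑ ∂μ = ENNReal.ofReal (∫ x, ‖F i x‖ ∂μ) := fun i =>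
    (ofReal_integral_norm_eq_lintegral_enorm (hF i)).symm
  simp only [h2]
  exact hs.tsum_ofReal_ne_top

/-- The coefficients of an absolutely summable expansion in an orthonormal system. -/
theorem integral_mul_of_hasSum_orthonormal [DecidableEq ι] {φ : ι → α → ℝ}
    (hint : ∀ n m, Integrable (fun x => φ n x * φ m x) μ)
    (horth : ∀ n m, ∫ x, φ n x * φ m x ∂μ = if n = m then 1 else 0)
    {a : ι → ℂ} (ha : Summable fun n => ‖a n‖) {f : α → ℂ}
    (hf : ∀ᵐ x ∂μ, HasSum (fun n => a n * (φ n x : ℂ)) (f x)) (k : ι) :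
    Integrable (fun x => f x * (φ k x : ℂ)) μ ∧ ∫ x, f x * (φ k x : ℂ) ∂μ = a k := by
  set F : ι → α → ℂ := fun n x => a n * ((φ n x * φ k x : ℝ) : ℂ) with hFdef
  have hF : ∀ n, Integrable (F n) μ := fun n => ((hint n k).ofReal).const_mul (a n)
  -- From `|φ_n φ_k| ≤ (φ_n² + φ_k²) / 2`; this uniform bound is why summability of `‖a n‖` is
  -- enough.
  have habs : ∀ n, ∫ x, |φ n x * φ k x| ∂μ ≤ 1 := fun n => by
    have h : ∫ x, |φ n x * φ k x| ∂μ ≤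
        ∫ x, (1 / 2 * (φ n x * φ n x) + 1 / 2 * (φ k x * φ k x)) ∂μ := by
      refine integral_mono (hint n k).abs
        (((hint n n).const_mul _).add ((hint k k).const_mul _)) fun x => ?_
      rw [abs_le]
      constructor <;> nlinarith [sq_nonneg (φ n x - φ k x), sq_nonneg (φ n x + φ k x)]
    rw [integral_add ((hint n n).const_mul _) ((hint k k).const_mul _), integral_const_mul,
      integral_const_mul, horth, horth, if_pos rfl, if_pos rfl] at h
    linarith
  have hs : Summable fun n => ∫ x, ‖F n x‖ ∂μ := by
    refine ha.of_nonneg_of_le (fun n => integral_nonneg fun x => norm_nonneg _) fun n => ?_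
    simp only [hFdef, norm_mul, Complex.norm_real, Real.norm_eq_abs]
    simp only [← abs_mul]
    rw [integral_const_mul]
    exact mul_le_of_le_one_right (norm_nonneg _) (habs n)
  have hg : ∀ᵐ x ∂μ, HasSum (fun n => F n x) (f x * (φ k x : ℂ)) := hf.mono fun x hx => by
    refine (hx.mul_right (φ k x : ℂ)).congr_fun fun n => ?_
    simp only [hFdef, Complex.ofReal_mul, mul_assoc]
  refine ⟨integrable_of_hasSum_of_summable_integral_norm hF hs hg, ?_⟩
  have h1 := hasSum_integral_of_summable_integral_norm hF hs
  rw [integral_congr_ae (hg.mono fun x hx => hx.tsum_eq)] at h1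
  refine h1.unique ?_
  have h2 : ∀ n, ∫ x, F n x ∂μ = if n = k then a k else 0 := fun n => by
    simp only [hFdef]
    rw [integral_const_mul, integral_complex_ofReal, horth]
    split_ifs with h
    · simp [h]
    · simp
  simp only [h2]
  exact hasSum_ite_eq k (a k)

end Orthonormal

theorem integrable_prod_mul {d : ℕ} {φ : ℕ → ℝ → ℝ} {μ : Measure ℝ} [SigmaFinite μ]
    (hint : ∀ n m, Integrable (fun x => φ n x * φ m x) μ) (n m : MultiIndex d) :
    Integrable (fun x : Fin d → ℝ => (∏ i, φ (n i) (x i)) * ∏ i, φ (m i) (x i))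
      (Measure.pi fun _ => μ) := by
  simp only [← Finset.prod_mul_distrib]
  exact Integrable.fintype_prod (f := fun i t => φ (n i) t * φ (m i) t) fun i => hint _ _

theorem integral_prod_mul {d : ℕ} {φ : ℕ → ℝ → ℝ} {μ : Measure ℝ} [SigmaFinite μ]
    (horth : ∀ n m, ∫ x, φ n x * φ m x ∂μ = if n = m then 1 else 0) (n m : MultiIndex d) :
    ∫ x : Fin d → ℝ, (∏ i, φ (n i) (x i)) * ∏ i, φ (m i) (x i) ∂(Measure.pi fun _ => μ) =
      if n = m then 1 else 0 := by
  simp only [← Finset.prod_mul_distrib]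
  rw [integral_fintype_prod_eq_prod (fun i t => φ (n i) t * φ (m i) t)]
  simp only [horth]
  by_cases h : n = m
  · simp [h]
  · obtain ⟨i, hi⟩ := Function.ne_iff.1 h
    rw [if_neg h]
    exact Finset.prod_eq_zero (Finset.mem_univ i) (if_neg hi)

theorem volume_restrict_orthant (d : ℕ) :
    (volume : Measure (Fin d → ℝ)).restrict (orthant d) =
      Measure.pi fun _ => (volume : Measure ℝ).restrict (Ioi 0) := by
  rw [← Measure.restrict_pi_pi, volume_pi]
  congr 1
  ext x
  simp [orthant]

theorem summable_prod_fin {β : Type*} {d : ℕ} {g : Fin d → β → ℝ} (h0 : ∀ i b, 0 ≤ g i b)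
    (hs : ∀ i, Summable (g i)) : Summable fun p : Fin d → β => ∏ i, g i (p i) := by
  induction d with
  | zero => exact Summable.of_finite
  | succ d ih =>
    rw [← (Fin.consEquiv fun _ : Fin (d + 1) => β).summable_iff]
    have := (hs 0).mul_of_nonneg (ih (fun i => h0 i.succ) fun i => hs i.succ) (h0 0)
      fun p => Finset.prod_nonneg fun i _ => h0 i.succ _
    refine this.congr fun p => ?_
    simp [Fin.prod_univ_succ, Fin.consEquiv]

/-! ### Factorial decay and the sequence spaces. -/

/-- The sequence `qⁿ (n!)^{-s}`. -/
noncomputable def decay (q s : ℝ) (n : ℕ) : ℝ := q ^ n * (n.factorial : ℝ) ^ (-s)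

theorem decay_pos {q : ℝ} (hq : 0 < q) (s : ℝ) (n : ℕ) : 0 < decay q s n := by
  unfold decay; positivity

theorem decay_mul_pow (q s K : ℝ) (n : ℕ) : decay q s n * K ^ n = decay (q * K) s n := by
  rw [decay, decay, mul_pow]; ring

/-- By `m! n! ≤ (m+n)!`; this separates the indices in `a_{k+n}`. -/
theorem decay_add_le {q s : ℝ} (hq : 0 < q) (hs : 0 < s) (m n : ℕ) :
    decay q s (m + n) ≤ decay q s m * decay q s n := by
  have h : ((m + n).factorial : ℝ) ^ (-s) ≤
      (m.factorial : ℝ) ^ (-s) * (n.factorial : ℝ) ^ (-s) := by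
    rw [← Real.mul_rpow (by positivity) (by positivity)]
    refine Real.rpow_le_rpow_of_nonpos (by positivity) ?_ (by linarith)
    exact_mod_cast Nat.le_of_dvd (Nat.factorial_pos _) (Nat.factorial_mul_factorial_dvd_factorial_add m n)
  calc decay q s (m + n) ≤ q ^ (m + n) *
        ((m.factorial : ℝ) ^ (-s) * (n.factorial : ℝ) ^ (-s)) := by
        unfold decay; gcongr
    _ = _ := by unfold decay; ring

theorem summable_decay {q s : ℝ} (hq : 0 < q) (hs : 0 < s) : Summable (decay q s) := by
  refine summable_of_ratio_test_tendsto_lt_one (l := 0) one_pos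
    (Eventually.of_forall fun n => (decay_pos hq s n).ne') ?_
  have h : ∀ n : ℕ, ‖decay q s (n + 1)‖ / ‖decay q s n‖ = q * ((n : ℝ) + 1) ^ (-s) := fun n => by
    rw [Real.norm_of_nonneg (decay_pos hq s _).le, Real.norm_of_nonneg (decay_pos hq s _).le,
      div_eq_iff (decay_pos hq s n).ne', decay, decay, Nat.factorial_succ, Nat.cast_mul,
      Real.mul_rpow (by positivity) (by positivity), Nat.cast_succ]
    ring
  simp only [h]
  have h2 := ((tendsto_rpow_neg_atTop hs).comp
    (tendsto_natCast_atTop_atTop.atTop_add tendsto_const_nhds)).const_mul q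
    (f := fun n : ℕ => ((n : ℝ) + 1) ^ (-s))
  simpa using h2

theorem factorial_double_le (n : ℕ) : (2 * n).factorial ≤ (2 ^ n * n.factorial) ^ 2 := by
  have h := Nat.choose_le_two_pow (2 * n) n
  have h2 := Nat.choose_mul_factorial_mul_factorial (show n ≤ 2 * n by omega)
  rw [show 2 * n - n = n by omega] at h2
  rw [← h2, mul_pow, ← pow_mul, mul_comm n 2, sq n.factorial, mul_assoc]
  gcongr

theorem sqrt_factorial_double_div_le (n : ℕ) :
    Real.sqrt ((2 * n).factorial : ℝ) / (2 ^ n * (n.factorial : ℝ)) ≤ 1 := by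
  rw [div_le_one (by positivity)]
  exact Real.sqrt_le_iff.2 ⟨by positivity, by exact_mod_cast factorial_double_le n⟩

/-- The exponent halves when the index doubles. This is the passage from `ℓ_{♭(σ/2)}` for Laguerre
to `ℓ_{♭σ}` for Hermite coefficients; the factor `2^n` is absorbed into `q`. -/
theorem decay_le_decay_double {q s : ℝ} (hq : 0 < q) (hs : 0 < s) (n : ℕ) :
    decay q s n ≤ decay (Real.sqrt (q * 2 ^ s)) (s / 2) (2 * n) := by
  have h1 : Real.sqrt (q * 2 ^ s) ^ (2 * n) = q ^ n * (2 ^ n : ℝ) ^ s := by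
    rw [pow_mul, Real.sq_sqrt (by positivity), mul_pow, ← Real.rpow_natCast (2 ^ s),
      ← Real.rpow_mul two_pos.le, ← Real.rpow_natCast 2, ← Real.rpow_mul two_pos.le, mul_comm s]
  have h2 : ((2 ^ n * (n.factorial : ℝ)) ^ 2) ^ (-(s / 2)) ≤
      ((2 * n).factorial : ℝ) ^ (-(s / 2)) :=
    Real.rpow_le_rpow_of_nonpos (by positivity) (by exact_mod_cast factorial_double_le n)
      (by linarith)
  have h3 : ((2 ^ n * (n.factorial : ℝ)) ^ 2) ^ (-(s / 2)) =
      ((2 ^ n : ℝ) ^ s)⁻¹ * (n.factorial : ℝ) ^ (-s) := by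
    rw [← Real.rpow_natCast _ 2, ← Real.rpow_mul (by positivity),
      Real.mul_rpow (by positivity) (by positivity), ← Real.rpow_neg (by positivity)]
    congr 2 <;> push_cast <;> ring
  rw [h3] at h2
  have h4 : (0 : ℝ) < (2 ^ n : ℝ) ^ s := by positivity
  calc decay q s n = q ^ n * (2 ^ n : ℝ) ^ s *
        (((2 ^ n : ℝ) ^ s)⁻¹ * (n.factorial : ℝ) ^ (-s)) := by
        rw [decay]; field_simp
    _ ≤ _ := by rw [decay, h1]; gcongr

theorem flatWeight_eq_prod {d : ℕ} (h σ : ℝ) (n : MultiIndex d) :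
    flatWeight h σ n = ∏ i, (h ^ n i * ((n i).factorial : ℝ) ^ (1 / (2 * σ))) := by
  rw [flatWeight, MultiIndex.len, MultiIndex.fact, Finset.prod_mul_distrib,
    Finset.prod_pow_eq_pow_sum, Nat.cast_prod, Real.finsetProd_rpow _ _ fun i _ => by positivity]

theorem flatWeight_mul_prod_decay {d : ℕ} {h : ℝ} (hh : 0 < h) (σ : ℝ) (n : MultiIndex d) :
    (∏ i, decay h⁻¹ (1 / (2 * σ)) (n i)) * flatWeight h σ n = 1 := by
  rw [flatWeight_eq_prod, ← Finset.prod_mul_distrib]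
  refine Finset.prod_eq_one fun i _ => ?_
  have : (0 : ℝ) < ((n i).factorial : ℝ) ^ (1 / (2 * σ)) := by positivity
  rw [decay, Real.rpow_neg (by positivity), inv_pow]
  field_simp

/-- With `q = h⁻¹`, membership becomes a bound by a product of one-variable sequences, to which
`summable_prod_fin` applies. -/
theorem mem_flatSeq_iff {d : ℕ} {σ : ℝ} {a : MultiIndex d → ℂ} :
    a ∈ flatSeq d σ ↔
      ∃ q > 0, ∃ C, ∀ n, ‖a n‖ ≤ C * ∏ i, decay q (1 / (2 * σ)) (n i) := by
  simp only [flatSeq, flatSeqStep, mem_iUnion, mem_ofPred_eq, mem_Ioi, exists_prop, BddAbove,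
    Set.Nonempty, mem_upperBounds, forall_mem_range]
  have key : ∀ h > 0, ∀ (C : ℝ) (n : MultiIndex d), ‖a n‖ * flatWeight h σ n ≤ C ↔
      ‖a n‖ ≤ C * ∏ i, decay h⁻¹ (1 / (2 * σ)) (n i) := fun h hh C n => by
    have hp : 0 < ∏ i, decay h⁻¹ (1 / (2 * σ)) (n i) :=
      Finset.prod_pos fun i _ => decay_pos (inv_pos.2 hh) _ _
    rw [← mul_le_mul_iff_left₀ hp, mul_assoc, mul_comm (flatWeight h σ n),
      flatWeight_mul_prod_decay hh, mul_one]
  constructor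
  · rintro ⟨h, hh, C, hC⟩
    exact ⟨h⁻¹, inv_pos.2 hh, C, fun n => (key h hh C n).1 (hC n)⟩
  · rintro ⟨q, hq, C, hC⟩
    refine ⟨q⁻¹, inv_pos.2 hq, C, fun n => (key _ (inv_pos.2 hq) C n).2 ?_⟩
    rw [inv_inv]; exact hC n

theorem summable_norm_of_mem_flatSeq {d : ℕ} {σ : ℝ} (hσ : 0 < σ) {a : MultiIndex d → ℂ}
    (ha : a ∈ flatSeq d σ) : Summable fun n => ‖a n‖ := by
  obtain ⟨q, hq, C, hC⟩ := mem_flatSeq_iff.1 ha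
  exact Summable.of_nonneg_of_le (fun n => norm_nonneg _) hC
    ((summable_prod_fin (fun _ n => (decay_pos hq _ n).le)
      fun _ => summable_decay hq (by positivity)).mul_left C)

theorem laguerreCoeff_eq {d : ℕ} {a : MultiIndex d → ℂ} (ha : Summable fun n => ‖a n‖)
    {f : (Fin d → ℝ) → ℂ} (hf : ∀ x ∈ closedOrthant d,
      HasSum (fun n : MultiIndex d => a n * (laguerreFun n x : ℂ)) (f x)) :
    laguerreCoeff f = a := by
  funext k
  have hm : MeasurableSet (orthant d) := by
    have : orthant d = univ.pi fun _ => Ioi 0 := by ext x; simp [orthant]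
    rw [this]
    exact MeasurableSet.univ_pi fun _ => measurableSet_Ioi
  have hae : ∀ᵐ x ∂(volume : Measure (Fin d → ℝ)).restrict (orthant d),
      HasSum (fun n : MultiIndex d => a n * (laguerreFun n x : ℂ)) (f x) :=
    (ae_restrict_mem hm).mono fun x hx => hf x fun i => (hx i).le
  rw [laguerreCoeff]
  rw [volume_restrict_orthant] at hae ⊢
  exact (integral_mul_of_hasSum_orthonormal (integrable_prod_mul integrableOn_laguerreFun₁_mul)
    (integral_prod_mul integral_laguerreFun₁_mul) ha hae k).2

theorem hermiteCoeff_eq {d : ℕ} {a : MultiIndex d → ℂ} (ha : Summable fun n => ‖a n‖)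
    {g : (Fin d → ℝ) → ℂ}
    (hg : ∀ x, HasSum (fun n : MultiIndex d => a n * (hermiteFun n x : ℂ)) (g x))
    (k : MultiIndex d) :
    Integrable (fun x => g x * (hermiteFun k x : ℂ)) ∧ hermiteCoeff g k = a k :=
  integral_mul_of_hasSum_orthonormal (integrable_prod_mul integrable_hermiteFun₁_mul)
    (integral_prod_mul integral_hermiteFun₁_mul) ha (Eventually.of_forall hg) k

end FlatPilipovic

/-! ### The double series and its two orders of summation. -/

namespace FlatPilipovic

open Filter Finset.HasAntidiagonal

/-- The factor in front of the series for `b_{2n}`. -/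
noncomputable def evenFactor {d : ℕ} (n : MultiIndex d) : ℝ :=
  (-1) ^ n.len * Real.pi ^ ((d : ℝ) / 4) * Real.sqrt (n.double.fact : ℝ)
    / (2 ^ n.len * (n.fact : ℝ))

theorem evenFactor_eq_prod {d : ℕ} (n : MultiIndex d) :
    evenFactor n = ∏ i, ((-1) ^ n i * Real.pi ^ ((1 : ℝ) / 4) *
      Real.sqrt ((2 * n i).factorial : ℝ) / (2 ^ n i * ((n i).factorial : ℝ))) := by
  have hpi : Real.pi ^ ((d : ℝ) / 4) = (Real.pi ^ ((1 : ℝ) / 4)) ^ d := by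
    rw [← Real.rpow_natCast, ← Real.rpow_mul Real.pi_pos.le]
    congr 1; ring
  have hsq : Real.sqrt (n.double.fact : ℝ) = ∏ i, Real.sqrt ((2 * n i).factorial : ℝ) := by
    rw [MultiIndex.fact, Nat.cast_prod, Real.sqrt_eq_rpow]
    simp only [Real.sqrt_eq_rpow]
    exact (Real.finsetProd_rpow _ _ (fun i _ => by positivity) _).symm
  rw [evenFactor, Finset.prod_div_distrib, Finset.prod_mul_distrib, Finset.prod_mul_distrib,
    Finset.prod_mul_distrib, Finset.prod_pow_eq_pow_sum, Finset.prod_pow_eq_pow_sum, hpi, hsq,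
    Finset.prod_const, Finset.card_univ, Fintype.card_fin, MultiIndex.len, MultiIndex.fact,
    Nat.cast_prod]

/-- The bound is uniform in `n`, so the factor costs no decay. -/
theorem abs_evenFactor_le {d : ℕ} (n : MultiIndex d) :
    |evenFactor n| ≤ (Real.pi ^ ((1 : ℝ) / 4)) ^ d := by
  rw [evenFactor_eq_prod, Finset.abs_prod]
  refine (Finset.prod_le_prod (fun i _ => abs_nonneg _)
    (g := fun _ => Real.pi ^ ((1 : ℝ) / 4)) fun i _ => ?_).trans_eq (by simp)
  rw [mul_div_assoc, abs_mul, abs_mul, abs_pow, abs_neg, abs_one, one_pow, one_mul,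
    abs_of_nonneg (by positivity), abs_of_nonneg (by positivity)]
  exact mul_le_of_le_one_right (by positivity) (sqrt_factorial_double_div_le _)

theorem evenFactor_mul_hermiteFun {d : ℕ} (n : MultiIndex d) (x : Fin d → ℝ) :
    evenFactor n * hermiteFun n.double x =
      ∏ i, ((evenHerm (n i)).eval (x i) * Real.exp (-x i ^ 2 / 2)) := by
  rw [evenFactor_eq_prod, hermiteFun, ← Finset.prod_mul_distrib]
  simp only [evenHerm_mul_exp]
  rfl

theorem evenCoeff_eq {d : ℕ} (a : MultiIndex d → ℂ) (n : MultiIndex d) :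
    evenCoeff a n = (evenFactor n : ℂ) * ∑' k, evenCoeffTerm a n k := rfl

theorem norm_evenCoeffTerm_le {d : ℕ} {a : MultiIndex d → ℂ} {q s C : ℝ} (hq : 0 < q) (hs : 0 < s)
    (hC : ∀ n, ‖a n‖ ≤ C * ∏ i, decay q s (n i)) (n k : MultiIndex d) :
    ‖evenCoeffTerm a n k‖ ≤ (C * ∏ i, decay q s (n i)) * ∏ i, decay q s (k i) := by
  have hp : 0 < ∏ i, decay q s ((k + n) i) := Finset.prod_pos fun i _ => decay_pos hq _ _
  have hC0 : 0 ≤ C := nonneg_of_mul_nonneg_left ((norm_nonneg _).trans (hC (k + n))) hp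
  have h1 : ‖(multiBinom (fun j => (k j : ℝ) - 1 / 2) k : ℂ)‖ ≤ 1 := by
    rw [Complex.norm_real, Real.norm_eq_abs, multiBinom, Finset.abs_prod]
    refine Finset.prod_le_one (fun i _ => abs_nonneg _) fun i _ => ?_
    rw [abs_of_nonneg (binom_half_mem _).1]
    exact (binom_half_mem _).2
  rw [evenCoeffTerm, norm_mul]
  calc _ ≤ (C * ∏ i, decay q s ((k + n) i)) * 1 :=
        mul_le_mul (hC _) h1 (norm_nonneg _) (by positivity)
    _ ≤ C * ∏ i, (decay q s (n i) * decay q s (k i)) := by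
        rw [mul_one]
        gcongr with i
        · exact fun i _ => (decay_pos hq _ _).le
        · rw [Pi.add_apply, add_comm]; exact decay_add_le hq hs _ _
    _ = _ := by rw [Finset.prod_mul_distrib, mul_assoc]

theorem summable_prod_decay {d : ℕ} {q s : ℝ} (hq : 0 < q) (hs : 0 < s) :
    Summable fun k : MultiIndex d => ∏ i, decay q s (k i) :=
  summable_prod_fin (fun _ n => (decay_pos hq _ n).le) fun _ => summable_decay hq hs

theorem summable_evenCoeffTerm {d : ℕ} {a : MultiIndex d → ℂ} {q s C : ℝ} (hq : 0 < q)
    (hs : 0 < s) (hC : ∀ n, ‖a n‖ ≤ C * ∏ i, decay q s (n i)) (n : MultiIndex d) :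
    Summable (evenCoeffTerm a n) :=
  Summable.of_norm_bounded ((summable_prod_decay hq hs).mul_left _)
    (norm_evenCoeffTerm_le hq hs hC n)

theorem norm_evenCoeff_le {d : ℕ} {a : MultiIndex d → ℂ} {q s C : ℝ} (hq : 0 < q) (hs : 0 < s)
    (hC : ∀ n, ‖a n‖ ≤ C * ∏ i, decay q s (n i)) :
    ∃ C' ≥ 0, ∀ n, ‖evenCoeff a n‖ ≤ C' * ∏ i, decay q s (n i) := by
  have hC0 : 0 ≤ C := nonneg_of_mul_nonneg_left ((norm_nonneg _).trans (hC 0))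
    (Finset.prod_pos fun i _ => decay_pos hq s _)
  set S := ∑' k : MultiIndex d, ∏ i, decay q s (k i)
  have hS0 : 0 ≤ S := tsum_nonneg fun k => Finset.prod_nonneg fun i _ => (decay_pos hq s _).le
  refine ⟨(Real.pi ^ ((1 : ℝ) / 4)) ^ d * (C * S), by positivity, fun n => ?_⟩
  rw [evenCoeff_eq, norm_mul, Complex.norm_real, mul_assoc]
  have h := tsum_of_norm_bounded ((summable_prod_decay hq hs).hasSum.mul_left _)
    (norm_evenCoeffTerm_le hq hs hC n)
  refine mul_le_mul (abs_evenFactor_le n) (h.trans_eq ?_) (norm_nonneg _) (by positivity)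
  ring

theorem double_injective {d : ℕ} : Function.Injective (MultiIndex.double (d := d)) := by
  intro m n h
  funext i
  have := congrFun h i
  simp only [MultiIndex.double] at this
  omega

theorem evenExtend_double {d : ℕ} (b : MultiIndex d → ℂ) (n : MultiIndex d) :
    evenExtend b n.double = b n := by
  simp [evenExtend, MultiIndex.double]

theorem evenExtend_eq_zero {d : ℕ} (b : MultiIndex d → ℂ) {k : MultiIndex d}
    (hk : k ∉ Set.range (MultiIndex.double (d := d))) : evenExtend b k = 0 := by
  rw [evenExtend, if_neg]
  intro h
  refine hk ⟨fun i => k i / 2, funext fun i => ?_⟩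
  exact Nat.two_mul_div_two_of_even (h i)

theorem evenExtend_mem_flatSeq {d : ℕ} {b : MultiIndex d → ℂ} {q σ C : ℝ} (hq : 0 < q)
    (hσ : 0 < σ) (hC0 : 0 ≤ C) (hC : ∀ n, ‖b n‖ ≤ C * ∏ i, decay q (1 / σ) (n i)) :
    evenExtend b ∈ flatSeq d σ := by
  have hs : 0 < 1 / σ := by positivity
  refine mem_flatSeq_iff.2 ⟨Real.sqrt (q * 2 ^ (1 / σ)), by positivity, C, fun k => ?_⟩
  by_cases hk : k ∈ Set.range (MultiIndex.double (d := d))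
  · obtain ⟨n, rfl⟩ := hk
    rw [evenExtend_double]
    refine (hC n).trans (mul_le_mul_of_nonneg_left ?_ hC0)
    refine Finset.prod_le_prod (fun i _ => (decay_pos hq _ _).le) fun i _ => ?_
    have := decay_le_decay_double hq hs (n i)
    rwa [div_div, mul_comm σ 2] at this
  · rw [evenExtend_eq_zero b hk, norm_zero]
    exact mul_nonneg hC0 (Finset.prod_nonneg fun i _ => (decay_pos (by positivity) _ _).le)

theorem hasSum_evenExtend_iff {d : ℕ} (b : MultiIndex d → ℂ) (x : Fin d → ℝ) (s : ℂ) :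
    HasSum (fun k : MultiIndex d => evenExtend b k * (hermiteFun k x : ℂ)) s ↔
      HasSum (fun n : MultiIndex d => b n * (hermiteFun n.double x : ℂ)) s := by
  rw [← double_injective.hasSum_iff]
  · simp only [Function.comp_def, evenExtend_double]
  · intro k hk
    rw [evenExtend_eq_zero b hk, zero_mul]

/-- The term of the double series with indices `n` and `k`, indexed by `i ↦ (n i, k i)`. -/
noncomputable def doubleTerm {d : ℕ} (a : MultiIndex d → ℂ) (x : Fin d → ℝ)
    (p : Fin d → ℕ × ℕ) : ℂ :=
  a (fun i => (p i).1 + (p i).2) * ((∏ i, (binom ((p i).2 - 1 / 2) (p i).2 *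
    ((evenHerm (p i).1).eval (x i) * Real.exp (-x i ^ 2 / 2))) : ℝ) : ℂ)

theorem doubleTerm_eq {d : ℕ} (a : MultiIndex d → ℂ) (x : Fin d → ℝ) (n k : MultiIndex d) :
    doubleTerm a x (fun i => (n i, k i)) =
      (evenFactor n * hermiteFun n.double x : ℝ) * evenCoeffTerm a n k := by
  rw [evenFactor_mul_hermiteFun, doubleTerm, evenCoeffTerm, Finset.prod_mul_distrib,
    show (fun i => n i + k i) = k + n from add_comm n k]
  simp only [multiBinom, Complex.ofReal_mul]
  ring

theorem summable_doubleTerm {d : ℕ} {a : MultiIndex d → ℂ} {q s C : ℝ} (hq : 0 < q) (hs : 0 < s)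
    (hC : ∀ n, ‖a n‖ ≤ C * ∏ i, decay q s (n i)) (x : Fin d → ℝ) :
    Summable (doubleTerm a x) := by
  have hK : ∀ i, 0 < 3 + x i ^ 2 := fun i => by positivity
  -- The growth `(3 + x_i²)^{n_i}` only changes the base of the geometric factor from `q` to `q (3 +
  -- x_i²)`.
  have h1 : Summable fun p : Fin d → ℕ × ℕ =>
      ∏ i, (decay (q * (3 + x i ^ 2)) s (p i).1 * decay q s (p i).2) :=
    summable_prod_fin
      (g := fun i (r : ℕ × ℕ) => decay (q * (3 + x i ^ 2)) s r.1 * decay q s r.2)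
      (fun i r => (mul_pos (decay_pos (mul_pos hq (hK i)) _ _) (decay_pos hq _ _)).le) fun i =>
      (summable_decay (mul_pos hq (hK i)) hs).mul_of_nonneg (summable_decay hq hs)
        (fun n => (decay_pos (mul_pos hq (hK i)) _ n).le) fun n => (decay_pos hq _ n).le
  refine Summable.of_norm_bounded (h1.mul_left C) fun p => ?_
  obtain ⟨n, k, rfl⟩ : ∃ n k : MultiIndex d, p = fun i => (n i, k i) :=
    ⟨fun i => (p i).1, fun i => (p i).2, rfl⟩
  rw [doubleTerm_eq, evenFactor_mul_hermiteFun, norm_mul, Complex.norm_real, Real.norm_eq_abs,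
    Finset.abs_prod]
  have h2 : ∏ i, |(evenHerm (n i)).eval (x i) * Real.exp (-x i ^ 2 / 2)| ≤
      ∏ i, (3 + x i ^ 2) ^ n i := by
    refine Finset.prod_le_prod (fun i _ => abs_nonneg _) fun i _ => ?_
    rw [abs_mul, Real.abs_exp]
    have : Real.exp (-x i ^ 2 / 2) ≤ 1 := Real.exp_le_one_iff.2 (by
      have := sq_nonneg (x i); linarith)
    exact (mul_le_of_le_one_right (abs_nonneg _) this).trans (abs_evenHerm_le _ _)
  refine (mul_le_mul h2 (norm_evenCoeffTerm_le hq hs hC n k) (norm_nonneg _)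
    (Finset.prod_nonneg fun i _ => (pow_pos (hK i) _).le)).trans_eq ?_
  simp only [← decay_mul_pow, Finset.prod_mul_distrib]
  ring

theorem laguerreFun_v {d : ℕ} (m : MultiIndex d) (x : Fin d → ℝ) :
    laguerreFun m (v x) = ∑ p ∈ Fintype.piFinset fun i => antidiagonal (m i),
      ∏ i, (binom ((p i).2 - 1 / 2) (p i).2 *
        ((evenHerm (p i).1).eval (x i) * Real.exp (-x i ^ 2 / 2))) := by
  simp only [laguerreFun, v, laguerreFun₁_sq]
  exact Finset.prod_univ_sum _ _

/-- Summing the double series along `n + k = m` gives the Laguerre series. -/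
theorem hasSum_doubleTerm_fiberwise {d : ℕ} {a : MultiIndex d → ℂ} {x : Fin d → ℝ}
    (h : Summable (doubleTerm a x)) :
    HasSum (fun m : MultiIndex d => a m * (laguerreFun m (v x) : ℂ)) (∑' p, doubleTerm a x p) := by
  refine (h.hasSum.tsum_fiberwise
    (fun (p : Fin d → ℕ × ℕ) i => (p i).1 + (p i).2)).congr_fun fun m => ?_
  have hfib : (fun (p : Fin d → ℕ × ℕ) i => (p i).1 + (p i).2) ⁻¹' {m} =
      ↑(Fintype.piFinset fun i => antidiagonal (m i)) := by
    ext p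
    simp [funext_iff]
  rw [hfib, Finset.tsum_subtype', laguerreFun_v, Complex.ofReal_sum, Finset.mul_sum]
  refine Finset.sum_congr rfl fun p hp => ?_
  have hpm : (fun i => (p i).1 + (p i).2) = m := funext fun i => by
    simpa using Fintype.mem_piFinset.1 hp i
  rw [doubleTerm, hpm]

/-- Summing the double series first over `k` gives the even Hermite series. -/
theorem hasSum_evenCoeff {d : ℕ} {a : MultiIndex d → ℂ} {q s C : ℝ} (hq : 0 < q) (hs : 0 < s)
    (hC : ∀ n, ‖a n‖ ≤ C * ∏ i, decay q s (n i)) (x : Fin d → ℝ) :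
    HasSum (fun n : MultiIndex d => evenCoeff a n * (hermiteFun n.double x : ℂ))
      (∑' p, doubleTerm a x p) := by
  have h := (summable_doubleTerm hq hs hC x).hasSum
  rw [← (Equiv.arrowProdEquivProdArrow (Fin d) (fun _ => ℕ) fun _ => ℕ).symm.hasSum_iff] at h
  refine h.prod_fiberwise fun n => ?_
  have h1 := ((summable_evenCoeffTerm hq hs hC n).hasSum).mul_left
    ((evenFactor n * hermiteFun (MultiIndex.double n) x : ℝ) : ℂ)
  have h2 : evenCoeff a n * (hermiteFun (MultiIndex.double n) x : ℂ) =
      ((evenFactor n * hermiteFun (MultiIndex.double n) x : ℝ) : ℂ) * ∑' k, evenCoeffTerm a n k := by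
    rw [evenCoeff_eq, Complex.ofReal_mul]; ring
  rw [h2]
  exact h1.congr_fun fun k => doubleTerm_eq a x n k

end FlatPilipovic

open FlatPilipovic

theorem mainTheorem10 (d : ℕ) (σ : ℝ) (hσ : 0 < σ) (f : (Fin d → ℝ) → ℂ)
    (hf : f ∈ FlatPilipovic.flatG d σ) :
    f ∘ FlatPilipovic.v ∈ FlatPilipovic.flatHEven d σ ∧
    (∀ n : FlatPilipovic.MultiIndex d,
      Summable (FlatPilipovic.evenCoeffTerm (FlatPilipovic.laguerreCoeff f) n)) ∧
    FlatPilipovic.evenExtend (FlatPilipovic.evenCoeff (FlatPilipovic.laguerreCoeff f)) ∈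
      FlatPilipovic.flatSeq d σ ∧
    (∀ x : Fin d → ℝ,
      HasSum (fun n : FlatPilipovic.MultiIndex d =>
        FlatPilipovic.evenCoeff (FlatPilipovic.laguerreCoeff f) n *
          (FlatPilipovic.hermiteFun n.double x : ℂ)) ((f ∘ FlatPilipovic.v) x)) ∧
    (∀ k : FlatPilipovic.MultiIndex d,
      MeasureTheory.Integrable (fun x : Fin d → ℝ =>
        (f ∘ FlatPilipovic.v) x * (FlatPilipovic.hermiteFun k x : ℂ)) ∧
      FlatPilipovic.hermiteCoeff (f ∘ FlatPilipovic.v) k =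
        FlatPilipovic.evenExtend
          (FlatPilipovic.evenCoeff (FlatPilipovic.laguerreCoeff f)) k) := by
  obtain ⟨a, ha, hfa⟩ := hf
  rw [laguerreCoeff_eq (summable_norm_of_mem_flatSeq (half_pos hσ) ha) hfa]
  obtain ⟨q, hq, C, hC⟩ := mem_flatSeq_iff.1 ha
  -- For `ℓ_{♭(σ/2)}` the decay exponent is `1 / (2 · (σ/2)) = 1 / σ`.
  rw [mul_div_cancel₀ σ two_ne_zero] at hC
  have hs : 0 < 1 / σ := by positivity
  have hsum : ∀ x : Fin d → ℝ,
      HasSum (fun n : MultiIndex d => evenCoeff a n * (hermiteFun n.double x : ℂ))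
        ((f ∘ v) x) := fun x => by
    have h1 := hasSum_evenCoeff hq hs hC x
    have h2 := hasSum_doubleTerm_fiberwise (summable_doubleTerm hq hs hC x)
    -- Uniqueness of sums identifies the double sum with `f (v x)`. When some `x i = 0`, the point
    -- `v x` lies on the boundary, so the Laguerre series is needed on the closed orthant.
    rwa [h2.unique (hfa (v x) fun i => sq_nonneg (x i))] at h1
  have hsum' := fun x => (hasSum_evenExtend_iff (evenCoeff a) x _).2 (hsum x)
  obtain ⟨C', hC0', hC'⟩ := norm_evenCoeff_le hq hs hC
  have hmem := evenExtend_mem_flatSeq hq hσ hC0' hC'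
  refine ⟨⟨⟨_, hmem, hsum'⟩, fun x j => ?_⟩, summable_evenCoeffTerm hq hs hC, hmem, hsum,
    hermiteCoeff_eq (summable_norm_of_mem_flatSeq hσ hmem) hsum'⟩
  refine congrArg f (funext fun i => ?_)
  rcases eq_or_ne i j with rfl | hij
  · simp [v]
  · simp [v, hij]
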